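/- Let $n\ge 1$, let $M^n$ be a connected smooth manifold and let $x:M^n\to\mathbb S^{n+1}\subset\mathbb R^{n+2}$ be a smooth immersion with a smooth unit normal vector field $\nu$ (tangent to $\mathbb S^{n+1}$, orthogonal to $dx(TM)$). Give $M$ the induced metric, let $\Delta$ be its Laplace–Beltrami operator (the trace of the Hessian), let $A(X)=-\widetilde\nabla_X\nu$ be the shape operator, where $\widetilde\nabla$ is the Levi-Civita connection of $\mathbb S^{n+1}$, and put $H=\operatorname{Tr}(A)/n$ and $S=\|A\|^2$. For a unit vector $a\in\mathbb S^{n+1}\subset\mathbb R^{n+2}$ let $\varphi_a=\langle x,a\rangle$ and $\psi_a=\langle \nu,a\rangle$ be the height functions on $M$. (i) $H$ is constant if and only if there exist a continuous function $\lambda:M\to\mathbb R$ and a constant $\mu\in\mathbb R$ such that $\Delta\varphi_a=-\lambda\varphi_a+n\mu\psi_a$ for all $a\in\mathbb S^{n+1}$; for any such $\lambda,\mu$ one has $\lambda=n$ and $\mu=H$. In particular, $H=0$ if and only if there exists a continuous function $\lambda$ such that $\Delta\varphi_a=-\lambda\varphi_a$ for all $a\in\mathbb S^{n+1}$. (ii)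 $H$ is constant if and only if there exist continuous functions $\lambda,\mu:M\to\mathbb R$ such that $\Delta\psi_a=-\lambda\psi_a+n\mu\varphi_a$ for all $a\in\mathbb S^{n+1}$; for any such $\lambda,\mu$ one has $\lambda=S$ and $\mu=H$, and $\mu$ is constant. In particular, $H=0$ if and only if there exists a continuous function $\lambda$ such that $\Delta\psi_a=-\lambda\psi_a$ for all $a\in\mathbb S^{n+1}$. (iii) $H$ and $S$ are both constant if and only if there exist a constant $\lambda\in\mathbb R$ and a continuous function $\mu:M\to\mathbb R$ such that $\Delta\psi_a=-\lambda\psi_a+n\mu\varphi_a$ for all $a\in\mathbb S^{n+1}$; for any such $\lambda,\mu$ one has $\lambda=S$ and $\mu=H$, and both are constant. In particular, $H=0$ and $S$ is constant if and only if there exists a constant $\lambda\in\mathbb R$ such that $\Delta\psi_a=-\lambda\psi_a$ for all $a\in\mathbb S^{n+1}$. -/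

import Mathlib

open scoped Manifold ContDiff RealInnerProductSpace

noncomputable section

/-! ### The Laplacian of a Riemannian metric in local coordinates -/

namespace LocalRiemannian

variable {n : ℕ}

/-- The partial derivative of `f` in the `i`-th coordinate direction at `y`. -/
def pderiv {F : Type*} [NormedAddCommGroup F] [NormedSpace ℝ F] (i : Fin n)
    (f : EuclideanSpace ℝ (Fin n) → F) (y : EuclideanSpace ℝ (Fin n)) : F :=
  fderiv ℝ f y (EuclideanSpace.single i 1)

/-- The Christoffel symbol of the Levi-Civita connection of the metric `G = (g_ij)`:
`Γ^k_ij = (1/2) ∑_l g^{kl} (∂_i g_jl + ∂_j g_il - ∂_l g_ij)`. -/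
def christoffel (G : EuclideanSpace ℝ (Fin n) → Matrix (Fin n) (Fin n) ℝ) (k i j : Fin n)
    (y : EuclideanSpace ℝ (Fin n)) : ℝ :=
  (1 / 2 : ℝ) * ∑ l, (G y)⁻¹ k l *
    (pderiv i (fun z => G z j l) y + pderiv j (fun z => G z i l) y - pderiv l (fun z => G z i j) y)

/-- The components of the Hessian `∇∇u` for the Levi-Civita connection of `G`:
`∂_i ∂_j u - ∑_k Γ^k_ij ∂_k u`. -/
def hessian (G : EuclideanSpace ℝ (Fin n) → Matrix (Fin n) (Fin n) ℝ)
    (u : EuclideanSpace ℝ (Fin n) → ℝ) (i j : Fin n) (y : EuclideanSpace ℝ (Fin n)) : ℝ :=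
  pderiv i (pderiv j u) y - ∑ k, christoffel G k i j y * pderiv k u y

/-- The Laplacian of `u`, the metric trace of the Hessian: `∑_ij g^{ij} (∇∇u)_ij`. -/
def laplacian (G : EuclideanSpace ℝ (Fin n) → Matrix (Fin n) (Fin n) ℝ)
    (u : EuclideanSpace ℝ (Fin n) → ℝ) (y : EuclideanSpace ℝ (Fin n)) : ℝ :=
  ∑ i, ∑ j, (G y)⁻¹ i j * hessian G u i j y

end LocalRiemannian

/-- The differential `T_p M → ℝ^m` at `p` of a map `f : M → ℝ^m`. -/
def euclideanDifferential (n : ℕ) {m : ℕ} {M : Type*} [TopologicalSpace M]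
    [ChartedSpace (EuclideanSpace ℝ (Fin n)) M] (f : M → EuclideanSpace ℝ (Fin m)) (p : M) :
    TangentSpace (𝓡 n) p →ₗ[ℝ] EuclideanSpace ℝ (Fin m) :=
  (mfderiv (𝓡 n) 𝓘(ℝ, EuclideanSpace ℝ (Fin m)) f p).toLinearMap

/-- A smooth hypersurface `x : M^n → 𝕊^{n+1} ⊂ ℝ^{n+2}` immersed in the unit sphere, together with
a smooth unit normal vector field `ν` along it (tangent to the sphere, orthogonal to `M`). -/
structure SphereHypersurface (n : ℕ) (M : Type*) [TopologicalSpace M]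
    [ChartedSpace (EuclideanSpace ℝ (Fin n)) M] where
  /-- the position vector `x` -/
  pos : M → EuclideanSpace ℝ (Fin (n + 2))
  /-- the unit normal vector field `ν` -/
  normal : M → EuclideanSpace ℝ (Fin (n + 2))
  smooth_pos : ContMDiff (𝓡 n) 𝓘(ℝ, EuclideanSpace ℝ (Fin (n + 2))) ∞ pos
  norm_pos : ∀ p, ‖pos p‖ = 1
  immersion : ∀ p, Function.Injective (euclideanDifferential n pos p)
  smooth_normal : ContMDiff (𝓡 n) 𝓘(ℝ, EuclideanSpace ℝ (Fin (n + 2))) ∞ normal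
  norm_normal : ∀ p, ‖normal p‖ = 1
  inner_pos_normal : ∀ p, ⟪pos p, normal p⟫ = 0
  inner_mfderiv_normal : ∀ p (v : TangentSpace (𝓡 n) p),
    ⟪euclideanDifferential n pos p v, normal p⟫ = 0

namespace SphereHypersurface

variable {n : ℕ} {M : Type*} [TopologicalSpace M] [ChartedSpace (EuclideanSpace ℝ (Fin n)) M]
  (X : SphereHypersurface n M)

/-- The position height function `φ_a = ⟨x, a⟩`. -/
def phi (a : EuclideanSpace ℝ (Fin (n + 2))) (p : M) : ℝ := ⟪X.pos p, a⟫

/-- The normal height function `ψ_a = ⟨ν, a⟩`. -/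
def psi (a : EuclideanSpace ℝ (Fin (n + 2))) (p : M) : ℝ := ⟪X.normal p, a⟫

/-- The tangent space of the hypersurface at `p`, as the subspace `dx_p(T_p M)` of `ℝ^{n+2}`. The
induced Riemannian metric is the inner product that it inherits from `ℝ^{n+2}`. -/
abbrev tangent (p : M) : Submodule ℝ (EuclideanSpace ℝ (Fin (n + 2))) :=
  LinearMap.range (euclideanDifferential n X.pos p)

/-- The isomorphism `T_p M ≃ dx_p(T_p M)` given by `dx_p`. -/
def tangentEquiv (p : M) : TangentSpace (𝓡 n) p ≃ₗ[ℝ] X.tangent p :=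
  LinearEquiv.ofInjective (euclideanDifferential n X.pos p) (X.immersion p)

/-- The shape operator `A` with respect to `ν`, i.e. `A(dx v) = -(dν v)^⊤`, where `⊤` is the
component tangent to the hypersurface. -/
def shapeOperator (p : M) : X.tangent p →ₗ[ℝ] X.tangent p :=
  -((X.tangent p).orthogonalProjectionOnto.toLinearMap ∘ₗ
    euclideanDifferential n X.normal p ∘ₗ (X.tangentEquiv p).symm.toLinearMap)

/-- The mean curvature `H = Tr(A) / n`. -/
def meanCurvature (p : M) : ℝ :=
  LinearMap.trace ℝ (X.tangent p) (X.shapeOperator p) / n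

/-- The squared length `S = ‖A‖² = ∑_i |A e_i|²` of the second fundamental form, where `(e_i)` is
an orthonormal basis of the tangent space. -/
def squaredLength (p : M) : ℝ :=
  ∑ i, ‖X.shapeOperator p (stdOrthonormalBasis ℝ (X.tangent p) i)‖ ^ 2

/-- The components `g_ij = ⟨∂_i x, ∂_j x⟩` of the induced metric in the chart around `p`. -/
def metricInChart (p : M) (y : EuclideanSpace ℝ (Fin n)) : Matrix (Fin n) (Fin n) ℝ :=
  Matrix.of fun i j =>
    ⟪LocalRiemannian.pderiv i (X.pos ∘ (extChartAt (𝓡 n) p).symm) y,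
      LocalRiemannian.pderiv j (X.pos ∘ (extChartAt (𝓡 n) p).symm) y⟫

/-- The Laplace–Beltrami operator of the induced metric, applied to `f : M → ℝ`, at the point `p`;
it is computed in the chart of `M` around `p` (the value does not depend on the chart). -/
def laplacian (f : M → ℝ) (p : M) : ℝ :=
  LocalRiemannian.laplacian (X.metricInChart p) (f ∘ (extChartAt (𝓡 n) p).symm)
    (extChartAt (𝓡 n) p p)

end SphereHypersurface

end

noncomputable section

/-! ### Linear algebra of frames -/

section Frames

variable {V : Type*} [NormedAddCommGroup V] [InnerProductSpace ℝ V]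

/-! The theorem follows from two identities between vectors of `ℝ^{n+2}`: `Δx = -n x + n H ν` and
`Δν = -S ν + n H x - n ∇H`. At each point `x`, `ν` and the coordinate vectors `∂_i x` form a frame,
so it suffices to compute components. Those along `x` and `ν` come from differentiating the constant
inner products of the frame. The tangential component of `Δx` vanishes by the Gauss formula
(`vectorLaplacian_pos`), and that of `Δν` is the contracted Codazzi equation
(`inner_vectorLaplacian_normal_pderiv_pos`).

Pairing with `a` gives `laplacian_phi` and `laplacian_psi`. Conversely, if an equation of the stated
form holds for all unit `a`, then `a = x(p)` and `a = ν(p)`, which are orthonormal, isolate the two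
coefficients (`coefficients_phi`, `coefficients_psi`). For `φ_a` no gradient occurs, and `H` is
constant because `μ` is. For `ψ_a` what remains is `⟨∇H, a⟩ = 0` for all unit `a`, so `∇H = 0` and
connectedness makes `H` constant.

The Laplacian at `p` is computed in the chart around `p`, and `H` is differentiated at `p` in that
same chart, so no change of charts is needed. -/

lemma Matrix.gram_inv_comm {ι : Type*} [Fintype ι] [DecidableEq ι] (e : ι → V) (i j : ι) :
    (Matrix.gram ℝ e)⁻¹ i j = (Matrix.gram ℝ e)⁻¹ j i := by
  have h : (Matrix.gram ℝ e).transpose = Matrix.gram ℝ e := by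
    ext i j
    simp [Matrix.gram_apply, real_inner_comm]
  conv_lhs => rw [← h, ← Matrix.transpose_nonsing_inv, Matrix.transpose_apply]

lemma Matrix.isUnit_det_gram {ι : Type*} [Fintype ι] [DecidableEq ι] {e : ι → V}
    (he : LinearIndependent ℝ e) : IsUnit (Matrix.gram ℝ e).det :=
  isUnit_iff_ne_zero.2 (Matrix.det_gram_ne_zero_iff_linearIndependent.2 he)

/-- The combination of the vectors `e k` whose inner products with the `e k` are `c k`. -/
lemma inner_sum_inv_gram_smul {ι : Type*} [Fintype ι] [DecidableEq ι] {e : ι → V}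
    (he : LinearIndependent ℝ e) (c : ι → ℝ) (l : ι) :
    ⟪∑ k, (∑ m, (Matrix.gram ℝ e)⁻¹ k m * c m) • e k, e l⟫ = c l := by
  have h1 := Matrix.mul_nonsing_inv _ (Matrix.isUnit_det_gram he)
  calc ⟪∑ k, (∑ m, (Matrix.gram ℝ e)⁻¹ k m * c m) • e k, e l⟫
      = ∑ k, Matrix.gram ℝ e l k * ((Matrix.gram ℝ e)⁻¹.mulVec c) k := by
        rw [sum_inner]
        refine Finset.sum_congr rfl fun k _ => ?_
        rw [real_inner_smul_left, mul_comm, Matrix.gram_apply, real_inner_comm]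
        rfl
    _ = ((Matrix.gram ℝ e).mulVec ((Matrix.gram ℝ e)⁻¹.mulVec c)) l := rfl
    _ = c l := by rw [Matrix.mulVec_mulVec, h1, Matrix.one_mulVec]

/-- The trace of an endomorphism in terms of a basis of an inner product space. -/
lemma LinearMap.trace_eq_sum_inv_gram {ι : Type*} [Fintype ι] [DecidableEq ι]
    (b : Module.Basis ι ℝ V) (L : V →ₗ[ℝ] V) :
    LinearMap.trace ℝ V L = ∑ i, ∑ j, (Matrix.gram ℝ b)⁻¹ i j * ⟪L (b i), b j⟫ := by
  have hrep : ∀ v i, b.repr v i = ∑ j, (Matrix.gram ℝ b)⁻¹ i j * ⟪v, b j⟫ := by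
    intro v i
    have : FiniteDimensional ℝ V := b.finiteDimensional_of_finite
    have hv : v = ∑ k, (∑ m, (Matrix.gram ℝ b)⁻¹ k m * ⟪v, b m⟫) • b k := by
      refine InnerProductSpace.ext_inner_right_basis b fun l => ?_
      rw [inner_sum_inv_gram_smul b.linearIndependent]
    conv_lhs => rw [hv]
    rw [Module.Basis.repr_sum_self]
  rw [LinearMap.trace_eq_matrix_trace ℝ b]
  simp only [Matrix.trace, Matrix.diag_apply, LinearMap.toMatrix_apply, hrep]

variable {n : ℕ}

/-- A vector orthogonal to a frame of `n` tangent vectors and to two orthonormal normal vectors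
of an `(n + 2)`-dimensional space vanishes. -/
lemma eq_zero_of_inner_frame [FiniteDimensional ℝ V] (hV : Module.finrank ℝ V = n + 2)
    {e : Fin n → V} {x ν v : V} (he : LinearIndependent ℝ e) (hx : ‖x‖ = 1) (hν : ‖ν‖ = 1)
    (hxν : ⟪x, ν⟫ = 0) (hex : ∀ i, ⟪e i, x⟫ = 0) (heν : ∀ i, ⟪e i, ν⟫ = 0)
    (hve : ∀ i, ⟪v, e i⟫ = 0) (hvx : ⟪v, x⟫ = 0) (hvν : ⟪v, ν⟫ = 0) : v = 0 := by
  set T := Submodule.span ℝ (Set.range e)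
  have hT : Module.finrank ℝ T = n := by simpa using finrank_span_eq_card he
  have hTo : Module.finrank ℝ Tᗮ = 2 := by
    have := T.finrank_add_finrank_orthogonal
    omega
  have hmem : ∀ w : V, (∀ i, ⟪e i, w⟫ = 0) → w ∈ Tᗮ := by
    intro w hw
    rw [Submodule.mem_orthogonal]
    intro u hu
    induction hu using Submodule.span_induction with
    | mem u hu => obtain ⟨i, rfl⟩ := hu; exact hw i
    | zero => simp
    | add a b _ _ ha hb => rw [inner_add_left, ha, hb, add_zero]
    | smul c a _ ha => rw [real_inner_smul_left, ha, mul_zero]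
  have hvT : v ∈ Tᗮ := hmem v fun i => by rw [real_inner_comm]; exact hve i
  -- The orthogonal complement of the frame's span has dimension 2, so the orthonormal pair `x`, `ν`
  -- is a basis of it.
  let f : Fin 2 → Tᗮ := ![⟨x, hmem x hex⟩, ⟨ν, hmem ν heν⟩]
  have hf : Orthonormal ℝ f := by
    rw [orthonormal_iff_ite]
    intro i j
    fin_cases i <;> fin_cases j <;>
      simp [f, hx, hν, hxν, real_inner_comm]
  let b := basisOfLinearIndependentOfCardEqFinrank hf.linearIndependent (by simp [hTo])
  have : (⟨v, hvT⟩ : Tᗮ) = 0 := by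
    refine InnerProductSpace.ext_inner_right_basis b fun i => ?_
    fin_cases i <;> simp [b, f, hvx, hvν]
  simpa using congrArg Subtype.val this

/-- The expansion of a vector in a frame consisting of tangent vectors `e i` and two orthonormal
normal vectors. -/
lemma eq_sum_frame [FiniteDimensional ℝ V] (hV : Module.finrank ℝ V = n + 2)
    {e : Fin n → V} {x ν : V} (he : LinearIndependent ℝ e) (hx : ‖x‖ = 1) (hν : ‖ν‖ = 1)
    (hxν : ⟪x, ν⟫ = 0) (hex : ∀ i, ⟪e i, x⟫ = 0) (heν : ∀ i, ⟪e i, ν⟫ = 0) (v : V) :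
    v = ∑ k, (∑ m, (Matrix.gram ℝ e)⁻¹ k m * ⟪v, e m⟫) • e k + ⟪v, ν⟫ • ν + ⟪v, x⟫ • x := by
  have hxe : ∀ i, ⟪x, e i⟫ = 0 := fun i => by rw [real_inner_comm, hex]
  have hνe : ∀ i, ⟪ν, e i⟫ = 0 := fun i => by rw [real_inner_comm, heν]
  have hνx : ⟪ν, x⟫ = 0 := by rw [real_inner_comm, hxν]
  rw [← sub_eq_zero]
  refine eq_zero_of_inner_frame hV he hx hν hxν hex heν (fun i => ?_) ?_ ?_
  · rw [inner_sub_left, inner_add_left, inner_add_left, inner_sum_inv_gram_smul he]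
    simp [real_inner_smul_left, hxe, hνe]
  · simp [inner_sub_left, inner_add_left, sum_inner, real_inner_smul_left, hex, hνx, hx]
  · simp [inner_sub_left, inner_add_left, sum_inner, real_inner_smul_left, heν, hxν, hν]

end Frames

/-! ### Calculus of partial derivatives -/

namespace LocalRiemannian

variable {n : ℕ} {F : Type*} [NormedAddCommGroup F] [NormedSpace ℝ F]

lemma pderiv_congr {f g : EuclideanSpace ℝ (Fin n) → F} {y : EuclideanSpace ℝ (Fin n)}
    (h : f =ᶠ[nhds y] g) (i : Fin n) : pderiv i f y = pderiv i g y := by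
  rw [pderiv, pderiv, h.fderiv_eq]

lemma pderiv_eventually_const {f : EuclideanSpace ℝ (Fin n) → F} {y : EuclideanSpace ℝ (Fin n)}
    {c : F} (h : ∀ᶠ z in nhds y, f z = c) (i : Fin n) : pderiv i f y = 0 := by
  rw [pderiv_congr (g := fun _ => c) h, pderiv]
  simp

lemma fderiv_eq_zero_of_pderiv_eq_zero {f : EuclideanSpace ℝ (Fin n) → F}
    {y : EuclideanSpace ℝ (Fin n)} (h : ∀ i, pderiv i f y = 0) : fderiv ℝ f y = 0 := by
  have : (fderiv ℝ f y).toLinearMap = 0 :=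
    (EuclideanSpace.basisFun (Fin n) ℝ).toBasis.ext fun i => by simpa [pderiv] using h i
  ext v
  exact congrArg (fun L : EuclideanSpace ℝ (Fin n) →ₗ[ℝ] F => L v) this

lemma contDiffAt_pderiv {f : EuclideanSpace ℝ (Fin n) → F} {y : EuclideanSpace ℝ (Fin n)}
    (h : ContDiffAt ℝ ∞ f y) (i : Fin n) : ContDiffAt ℝ ∞ (pderiv i f) y :=
  (h.fderiv_right (m := ∞) (by simp)).clm_apply contDiffAt_const

lemma pderiv_comm {f : EuclideanSpace ℝ (Fin n) → F} {y : EuclideanSpace ℝ (Fin n)}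
    (h : ContDiffAt ℝ ∞ f y) (i j : Fin n) :
    pderiv i (pderiv j f) y = pderiv j (pderiv i f) y := by
  have hd : DifferentiableAt ℝ (fderiv ℝ f) y :=
    (h.fderiv_right (m := ∞) (by simp)).differentiableAt (by simp)
  have key : ∀ i j : Fin n, pderiv i (pderiv j f) y =
      fderiv ℝ (fderiv ℝ f) y (EuclideanSpace.single i 1) (EuclideanSpace.single j 1) := by
    intro i j
    unfold pderiv
    rw [fderiv_clm_apply hd (differentiableAt_const _)]
    simp
  rw [key, key]
  exact (h.isSymmSndFDerivAt (by simpa using ENat.LEInfty.out)) _ _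

lemma pderiv_neg (f : EuclideanSpace ℝ (Fin n) → F) (y : EuclideanSpace ℝ (Fin n)) (i : Fin n) :
    pderiv i (fun z => -f z) y = -pderiv i f y := by
  unfold pderiv
  rw [fderiv_fun_neg]
  rfl

lemma pderiv_sum {ι : Type*} (s : Finset ι) {f : ι → EuclideanSpace ℝ (Fin n) → F}
    {y : EuclideanSpace ℝ (Fin n)} (h : ∀ a ∈ s, DifferentiableAt ℝ (f a) y) (i : Fin n) :
    pderiv i (fun z => ∑ a ∈ s, f a z) y = ∑ a ∈ s, pderiv i (f a) y := by
  unfold pderiv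
  rw [fderiv_fun_sum h]
  simp

lemma pderiv_mul {f g : EuclideanSpace ℝ (Fin n) → ℝ} {y : EuclideanSpace ℝ (Fin n)}
    (hf : DifferentiableAt ℝ f y) (hg : DifferentiableAt ℝ g y) (i : Fin n) :
    pderiv i (fun z => f z * g z) y = pderiv i f y * g y + f y * pderiv i g y := by
  unfold pderiv
  rw [fderiv_fun_mul hf hg]
  simp
  ring

lemma pderiv_inner {V : Type*} [NormedAddCommGroup V] [InnerProductSpace ℝ V]
    {f g : EuclideanSpace ℝ (Fin n) → V} {y : EuclideanSpace ℝ (Fin n)}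
    (hf : DifferentiableAt ℝ f y) (hg : DifferentiableAt ℝ g y) (i : Fin n) :
    pderiv i (fun z => ⟪f z, g z⟫) y = ⟪pderiv i f y, g y⟫ + ⟪f y, pderiv i g y⟫ := by
  unfold pderiv
  rw [fderiv_inner_apply ℝ hf hg, add_comm]

lemma pderiv_inner_const {V : Type*} [NormedAddCommGroup V] [InnerProductSpace ℝ V]
    {f : EuclideanSpace ℝ (Fin n) → V} {y : EuclideanSpace ℝ (Fin n)}
    (hf : DifferentiableAt ℝ f y) (a : V) (i : Fin n) :
    pderiv i (fun z => ⟪f z, a⟫) y = ⟪pderiv i f y, a⟫ := by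
  rw [pderiv_inner hf (differentiableAt_const a), pderiv_eventually_const (f := fun _ => a) (c := a) (by simp)]
  simp

lemma differentiableAt_det {A : EuclideanSpace ℝ (Fin n) → Matrix (Fin n) (Fin n) ℝ}
    {y : EuclideanSpace ℝ (Fin n)} (hA : ∀ i j, DifferentiableAt ℝ (fun z => A z i j) y) :
    DifferentiableAt ℝ (fun z => (A z).det) y := by
  simp only [Matrix.det_apply']
  refine DifferentiableAt.fun_sum fun σ _ => ?_
  exact (HasFDerivAt.finsetProd fun i _ => (hA (σ i) i).hasFDerivAt).differentiableAt.const_mul _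

/-- Cramer's rule: an entry of the inverse is an entry of the adjugate, itself a determinant,
divided by `det A`. -/
lemma differentiableAt_inv_apply {A : EuclideanSpace ℝ (Fin n) → Matrix (Fin n) (Fin n) ℝ}
    {y : EuclideanSpace ℝ (Fin n)} (hA : ∀ i j, DifferentiableAt ℝ (fun z => A z i j) y)
    (hy : IsUnit (A y).det) (i j : Fin n) : DifferentiableAt ℝ (fun z => (A z)⁻¹ i j) y := by
  simp only [Matrix.inv_def, Matrix.smul_apply, Ring.inverse_eq_inv', smul_eq_mul,
    Matrix.adjugate_apply]
  refine ((differentiableAt_det hA).inv hy.ne_zero).mul (differentiableAt_det fun k l => ?_)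
  simp only [Matrix.updateRow_apply]
  split_ifs
  · exact differentiableAt_const _
  · exact hA k l

/-- The derivative of the inverse of a matrix: `∂_l A⁻¹ = -A⁻¹ (∂_l A) A⁻¹`. -/
lemma pderiv_inv_apply {A : EuclideanSpace ℝ (Fin n) → Matrix (Fin n) (Fin n) ℝ}
    {y : EuclideanSpace ℝ (Fin n)} (hA : ∀ i j, DifferentiableAt ℝ (fun z => A z i j) y)
    (hy : IsUnit (A y).det) (l i j : Fin n) :
    pderiv l (fun z => (A z)⁻¹ i j) y =
      -((A y)⁻¹ * Matrix.of (fun a b => pderiv l (fun z => A z a b) y) * (A y)⁻¹) i j := by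
  set D : Matrix (Fin n) (Fin n) ℝ := Matrix.of (fun a b => pderiv l (fun z => A z a b) y)
  set D' : Matrix (Fin n) (Fin n) ℝ := Matrix.of (fun a b => pderiv l (fun z => (A z)⁻¹ a b) y)
  have hunit : ∀ᶠ z in nhds y, IsUnit (A z).det := by
    filter_upwards [(differentiableAt_det hA).continuousAt.eventually_ne hy.ne_zero] with z hz
    exact isUnit_iff_ne_zero.2 hz
  have hI := differentiableAt_inv_apply hA hy
  -- This is the derivative of `A⁻¹ A = 1`, an identity that holds near `y` because invertibility is
  -- an open condition.
  have key : D' * A y + (A y)⁻¹ * D = 0 := by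
    ext a b
    have h0 : pderiv l (fun z => ∑ c, (A z)⁻¹ a c * A z c b) y = 0 := by
      refine pderiv_eventually_const (c := (1 : Matrix (Fin n) (Fin n) ℝ) a b) ?_ l
      filter_upwards [hunit] with z hz
      rw [← Matrix.nonsing_inv_mul _ hz, Matrix.mul_apply]
    rw [pderiv_sum (f := fun c z => (A z)⁻¹ a c * A z c b) _
      fun c _ => (hI a c).mul (hA c b)] at h0
    simp only [pderiv_mul (hI _ _) (hA _ _), Finset.sum_add_distrib] at h0
    simpa [Matrix.mul_apply, D, D'] using h0
  have : D' = -((A y)⁻¹ * D * (A y)⁻¹) := by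
    calc D' = D' * (A y * (A y)⁻¹) := by rw [Matrix.mul_nonsing_inv _ hy, mul_one]
      _ = (D' * A y) * (A y)⁻¹ := by rw [mul_assoc]
      _ = _ := by rw [eq_neg_of_add_eq_zero_left key, neg_mul]
  exact congrFun (congrFun this i) j

end LocalRiemannian

/-! ### Hypersurfaces of the sphere in local coordinates -/

namespace LocalRiemannian

variable {n : ℕ} {V : Type*} [NormedAddCommGroup V] [InnerProductSpace ℝ V]

/-- A parametrized immersed hypersurface `x : U → V` of the unit sphere of `V`, with unit normal
vector field `ν`. -/
structure IsSphereHypersurfaceOn (U : Set (EuclideanSpace ℝ (Fin n)))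
    (x ν : EuclideanSpace ℝ (Fin n) → V) : Prop where
  isOpen : IsOpen U
  contDiffAt_pos : ∀ y ∈ U, ContDiffAt ℝ ∞ x y
  contDiffAt_normal : ∀ y ∈ U, ContDiffAt ℝ ∞ ν y
  norm_pos : ∀ y ∈ U, ‖x y‖ = 1
  norm_normal : ∀ y ∈ U, ‖ν y‖ = 1
  inner_pos_normal : ∀ y ∈ U, ⟪x y, ν y⟫ = 0
  inner_pderiv_pos_normal : ∀ y ∈ U, ∀ i, ⟪pderiv i x y, ν y⟫ = 0
  linearIndependent : ∀ y ∈ U, LinearIndependent ℝ fun i => pderiv i x y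

/-- The matrix of the induced metric of a parametrization. -/
def inducedMetric (x : EuclideanSpace ℝ (Fin n) → V) (y : EuclideanSpace ℝ (Fin n)) :
    Matrix (Fin n) (Fin n) ℝ :=
  Matrix.gram ℝ fun i => pderiv i x y

/-- The Laplacian of a vector-valued function. -/
def vectorLaplacian (G : EuclideanSpace ℝ (Fin n) → Matrix (Fin n) (Fin n) ℝ)
    (f : EuclideanSpace ℝ (Fin n) → V) (y : EuclideanSpace ℝ (Fin n)) : V :=
  ∑ i, ∑ j, (G y)⁻¹ i j • (pderiv i (pderiv j f) y - ∑ k, christoffel G k i j y • pderiv k f y)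

/-- The trace `n H` of the shape operator in coordinates. -/
def traceShape (x ν : EuclideanSpace ℝ (Fin n) → V) (y : EuclideanSpace ℝ (Fin n)) : ℝ :=
  -∑ i, ∑ j, (inducedMetric x y)⁻¹ i j * ⟪pderiv i ν y, pderiv j x y⟫

/-- The squared length of the second fundamental form in coordinates. -/
def sqLength (x ν : EuclideanSpace ℝ (Fin n) → V) (y : EuclideanSpace ℝ (Fin n)) : ℝ :=
  ∑ i, ∑ j, (inducedMetric x y)⁻¹ i j * ⟪pderiv i ν y, pderiv j ν y⟫

/-- A constant vector passes through every derivative, so one vector-valued Laplacian governs the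
height functions of all `a` at once. -/
lemma laplacian_inner_const (G : EuclideanSpace ℝ (Fin n) → Matrix (Fin n) (Fin n) ℝ)
    {f : EuclideanSpace ℝ (Fin n) → V} {y : EuclideanSpace ℝ (Fin n)}
    (hf : ∀ᶠ z in nhds y, ContDiffAt ℝ ∞ f z) (a : V) :
    laplacian G (fun z => ⟪f z, a⟫) y = ⟪vectorLaplacian G f y, a⟫ := by
  have h1 : ∀ j, pderiv j (fun z => ⟪f z, a⟫) =ᶠ[nhds y] fun z => ⟪pderiv j f z, a⟫ := by
    intro j
    filter_upwards [hf] with z hz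
    exact pderiv_inner_const (hz.differentiableAt (by simp)) a j
  have h2 : ∀ i j, pderiv i (pderiv j (fun z => ⟪f z, a⟫)) y = ⟪pderiv i (pderiv j f) y, a⟫ := by
    intro i j
    rw [pderiv_congr (h1 j),
      pderiv_inner_const ((contDiffAt_pderiv hf.self_of_nhds j).differentiableAt (by simp))]
  have h3 : ∀ k, pderiv k (fun z => ⟪f z, a⟫) y = ⟪pderiv k f y, a⟫ :=
    fun k => (h1 k).self_of_nhds
  simp only [laplacian, hessian, vectorLaplacian, h2, h3, sum_inner, real_inner_smul_left,
    inner_sub_left]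

lemma inner_vectorLaplacian (G : EuclideanSpace ℝ (Fin n) → Matrix (Fin n) (Fin n) ℝ)
    (f : EuclideanSpace ℝ (Fin n) → V) (y : EuclideanSpace ℝ (Fin n)) (a : V) :
    ⟪vectorLaplacian G f y, a⟫ = ∑ i, ∑ j, (G y)⁻¹ i j *
      (⟪pderiv i (pderiv j f) y, a⟫ - ∑ k, christoffel G k i j y * ⟪pderiv k f y, a⟫) := by
  simp only [vectorLaplacian, sum_inner, real_inner_smul_left, inner_sub_left]

/-! ### Structure equations of a hypersurface in coordinates -/

namespace IsSphereHypersurfaceOn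

variable {U : Set (EuclideanSpace ℝ (Fin n))} {x ν : EuclideanSpace ℝ (Fin n) → V}
  (h : IsSphereHypersurfaceOn U x ν)
  {y : EuclideanSpace ℝ (Fin n)}

include h

lemma differentiableAt_pos (hy : y ∈ U) : DifferentiableAt ℝ x y :=
  (h.contDiffAt_pos y hy).differentiableAt (by simp)

lemma differentiableAt_normal (hy : y ∈ U) : DifferentiableAt ℝ ν y :=
  (h.contDiffAt_normal y hy).differentiableAt (by simp)

lemma differentiableAt_pderiv_pos (hy : y ∈ U) (i : Fin n) : DifferentiableAt ℝ (pderiv i x) y :=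
  (contDiffAt_pderiv (h.contDiffAt_pos y hy) i).differentiableAt (by simp)

lemma differentiableAt_pderiv_normal (hy : y ∈ U) (i : Fin n) :
    DifferentiableAt ℝ (pderiv i ν) y :=
  (contDiffAt_pderiv (h.contDiffAt_normal y hy) i).differentiableAt (by simp)

/-- The source of the frame relations below: each comes from differentiating an inner product that
is constant on `U`. -/
lemma pderiv_inner_eq_zero {f g : EuclideanSpace ℝ (Fin n) → V} {c : ℝ} (hy : y ∈ U)
    (hf : DifferentiableAt ℝ f y) (hg : DifferentiableAt ℝ g y) (hc : ∀ z ∈ U, ⟪f z, g z⟫ = c)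
    (i : Fin n) : ⟪pderiv i f y, g y⟫ + ⟪f y, pderiv i g y⟫ = 0 := by
  rw [← pderiv_inner hf hg]
  refine pderiv_eventually_const (c := c) ?_ i
  filter_upwards [h.isOpen.mem_nhds hy] with z hz using hc z hz

lemma inner_pderiv_pos_pos (hy : y ∈ U) (i : Fin n) : ⟪pderiv i x y, x y⟫ = 0 := by
  have := h.pderiv_inner_eq_zero hy (h.differentiableAt_pos hy) (h.differentiableAt_pos hy)
    (c := 1) (fun z hz => by rw [real_inner_self_eq_norm_sq, h.norm_pos z hz, one_pow]) i
  rw [real_inner_comm (pderiv i x y) (x y)] at this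
  linarith

lemma inner_pderiv_normal_normal (hy : y ∈ U) (i : Fin n) : ⟪pderiv i ν y, ν y⟫ = 0 := by
  have := h.pderiv_inner_eq_zero hy (h.differentiableAt_normal hy) (h.differentiableAt_normal hy)
    (c := 1) (fun z hz => by rw [real_inner_self_eq_norm_sq, h.norm_normal z hz, one_pow]) i
  rw [real_inner_comm (pderiv i ν y) (ν y)] at this
  linarith

lemma inner_pderiv_normal_pos (hy : y ∈ U) (i : Fin n) : ⟪pderiv i ν y, x y⟫ = 0 := by
  have := h.pderiv_inner_eq_zero hy (h.differentiableAt_pos hy) (h.differentiableAt_normal hy)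
    h.inner_pos_normal i
  rw [h.inner_pderiv_pos_normal y hy, zero_add] at this
  rw [real_inner_comm, this]

lemma inner_pderiv_pderiv_pos_pos (hy : y ∈ U) (i j : Fin n) :
    ⟪pderiv i (pderiv j x) y, x y⟫ = -inducedMetric x y i j := by
  have := h.pderiv_inner_eq_zero hy (h.differentiableAt_pderiv_pos hy j)
    (h.differentiableAt_pos hy) (fun z hz => h.inner_pderiv_pos_pos hz j) i
  rw [inducedMetric, Matrix.gram_apply, real_inner_comm (pderiv j x y)]
  linarith

lemma inner_pderiv_pderiv_pos_normal (hy : y ∈ U) (i j : Fin n) :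
    ⟪pderiv i (pderiv j x) y, ν y⟫ = -⟪pderiv i ν y, pderiv j x y⟫ := by
  have := h.pderiv_inner_eq_zero hy (h.differentiableAt_pderiv_pos hy j)
    (h.differentiableAt_normal hy) (fun z hz => h.inner_pderiv_pos_normal z hz j) i
  rw [real_inner_comm (pderiv j x y)]
  linarith

/-- Symmetry of the second fundamental form: up to sign both sides are the normal component of `∂_i
∂_j x`, and partial derivatives commute. -/
lemma inner_pderiv_normal_pderiv_pos_comm (hy : y ∈ U) (i j : Fin n) :
    ⟪pderiv i ν y, pderiv j x y⟫ = ⟪pderiv j ν y, pderiv i x y⟫ := by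
  rw [← neg_inj, ← h.inner_pderiv_pderiv_pos_normal hy, ← h.inner_pderiv_pderiv_pos_normal hy,
    pderiv_comm (h.contDiffAt_pos y hy)]

lemma inner_pderiv_pderiv_normal_normal (hy : y ∈ U) (i j : Fin n) :
    ⟪pderiv i (pderiv j ν) y, ν y⟫ = -⟪pderiv i ν y, pderiv j ν y⟫ := by
  have := h.pderiv_inner_eq_zero hy (h.differentiableAt_pderiv_normal hy j)
    (h.differentiableAt_normal hy) (fun z hz => h.inner_pderiv_normal_normal hz j) i
  rw [real_inner_comm (pderiv j ν y)]
  linarith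

lemma inner_pderiv_pderiv_normal_pos (hy : y ∈ U) (i j : Fin n) :
    ⟪pderiv i (pderiv j ν) y, x y⟫ = -⟪pderiv i ν y, pderiv j x y⟫ := by
  have := h.pderiv_inner_eq_zero hy (h.differentiableAt_pderiv_normal hy j)
    (h.differentiableAt_pos hy) (fun z hz => h.inner_pderiv_normal_pos hz j) i
  rw [h.inner_pderiv_normal_pderiv_pos_comm hy]
  linarith

lemma isUnit_det_inducedMetric (hy : y ∈ U) : IsUnit (inducedMetric x y).det :=
  Matrix.isUnit_det_gram (h.linearIndependent y hy)

lemma pderiv_inducedMetric (hy : y ∈ U) (l i j : Fin n) :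
    pderiv l (fun z => inducedMetric x z i j) y =
      ⟪pderiv l (pderiv i x) y, pderiv j x y⟫ + ⟪pderiv i x y, pderiv l (pderiv j x) y⟫ :=
  pderiv_inner (h.differentiableAt_pderiv_pos hy i) (h.differentiableAt_pderiv_pos hy j) l

lemma differentiableAt_inducedMetric (hy : y ∈ U) (i j : Fin n) :
    DifferentiableAt ℝ (fun z => inducedMetric x z i j) y :=
  (h.differentiableAt_pderiv_pos hy i).inner ℝ (h.differentiableAt_pderiv_pos hy j)

lemma differentiableAt_traceShape (hy : y ∈ U) : DifferentiableAt ℝ (traceShape x ν) y := by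
  refine (DifferentiableAt.fun_sum fun i _ => DifferentiableAt.fun_sum fun j _ => ?_).fun_neg
  exact (differentiableAt_inv_apply (h.differentiableAt_inducedMetric hy)
    (h.isUnit_det_inducedMetric hy) i j).mul
    ((h.differentiableAt_pderiv_normal hy i).inner ℝ (h.differentiableAt_pderiv_pos hy j))

lemma differentiableAt_sqLength (hy : y ∈ U) : DifferentiableAt ℝ (sqLength x ν) y := by
  refine DifferentiableAt.fun_sum fun i _ => DifferentiableAt.fun_sum fun j _ => ?_
  exact (differentiableAt_inv_apply (h.differentiableAt_inducedMetric hy)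
    (h.isUnit_det_inducedMetric hy) i j).mul
    ((h.differentiableAt_pderiv_normal hy i).inner ℝ (h.differentiableAt_pderiv_normal hy j))

/-- For `g_ij = ⟨∂_i x, ∂_j x⟩` the three metric derivatives expand into six terms; four cancel, and
the other two are equal, which absorbs the factor `1/2`. -/
lemma christoffel_inducedMetric (hy : y ∈ U) (k i j : Fin n) :
    christoffel (inducedMetric x) k i j y =
      ∑ l, (inducedMetric x y)⁻¹ k l * ⟪pderiv i (pderiv j x) y, pderiv l x y⟫ := by
  rw [christoffel, Finset.mul_sum]
  refine Finset.sum_congr rfl fun l _ => ?_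
  rw [h.pderiv_inducedMetric hy, h.pderiv_inducedMetric hy, h.pderiv_inducedMetric hy,
    pderiv_comm (h.contDiffAt_pos y hy) j i, pderiv_comm (h.contDiffAt_pos y hy) l i,
    pderiv_comm (h.contDiffAt_pos y hy) l j, real_inner_comm _ (pderiv j x y)]
  ring

/-- `⟨Δν, ν⟩ = -S`. -/
lemma inner_vectorLaplacian_normal_normal (hy : y ∈ U) :
    ⟪vectorLaplacian (inducedMetric x) ν y, ν y⟫ = -sqLength x ν y := by
  simp [inner_vectorLaplacian, h.inner_pderiv_normal_normal hy,
    h.inner_pderiv_pderiv_normal_normal hy, sqLength]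

/-- `⟨Δν, x⟩ = n H`. -/
lemma inner_vectorLaplacian_normal_pos (hy : y ∈ U) :
    ⟪vectorLaplacian (inducedMetric x) ν y, x y⟫ = traceShape x ν y := by
  simp [inner_vectorLaplacian, h.inner_pderiv_normal_pos hy,
    h.inner_pderiv_pderiv_normal_pos hy, traceShape]

variable [FiniteDimensional ℝ V]

lemma eq_sum_frame (hV : Module.finrank ℝ V = n + 2) (hy : y ∈ U) (v : V) :
    v = ∑ k, (∑ m, (inducedMetric x y)⁻¹ k m * ⟪v, pderiv m x y⟫) • pderiv k x y
      + ⟪v, ν y⟫ • ν y + ⟪v, x y⟫ • x y :=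
  _root_.eq_sum_frame hV (h.linearIndependent y hy) (h.norm_pos y hy) (h.norm_normal y hy)
    (h.inner_pos_normal y hy) (h.inner_pderiv_pos_pos hy) (h.inner_pderiv_pos_normal y hy) v

/-- The Gauss formula. -/
lemma pderiv_pderiv_pos (hV : Module.finrank ℝ V = n + 2) (hy : y ∈ U) (i j : Fin n) :
    pderiv i (pderiv j x) y = ∑ k, christoffel (inducedMetric x) k i j y • pderiv k x y
      - ⟪pderiv i ν y, pderiv j x y⟫ • ν y - inducedMetric x y i j • x y := by
  conv_lhs => rw [h.eq_sum_frame hV hy (pderiv i (pderiv j x) y)]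
  rw [h.inner_pderiv_pderiv_pos_pos hy, h.inner_pderiv_pderiv_pos_normal hy, neg_smul, neg_smul]
  simp only [h.christoffel_inducedMetric hy]
  abel

/-- `Δ x = -n x + n H ν`. -/
lemma vectorLaplacian_pos (hV : Module.finrank ℝ V = n + 2) (hy : y ∈ U) :
    vectorLaplacian (inducedMetric x) x y = traceShape x ν y • ν y - (n : ℝ) • x y := by
  -- The coefficient `n` is the trace of `g⁻¹ g = 1`.
  have hn : ∑ i, ∑ j, (inducedMetric x y)⁻¹ i j * inducedMetric x y i j = n := by
    have hsymm : ∀ i j, inducedMetric x y i j = inducedMetric x y j i := by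
      intro i j
      simp [inducedMetric, Matrix.gram_apply, real_inner_comm]
    have := congrArg Matrix.trace (Matrix.nonsing_inv_mul _ (h.isUnit_det_inducedMetric hy))
    rw [Matrix.trace_one, Fintype.card_fin] at this
    rw [← this]
    refine Finset.sum_congr rfl fun i _ => ?_
    rw [Matrix.diag_apply, Matrix.mul_apply]
    exact Finset.sum_congr rfl fun j _ => by rw [hsymm i j]
  have key : ∀ i j, pderiv i (pderiv j x) y
      - ∑ k, christoffel (inducedMetric x) k i j y • pderiv k x y
      = -(⟪pderiv i ν y, pderiv j x y⟫ • ν y + inducedMetric x y i j • x y) := by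
    intro i j
    rw [h.pderiv_pderiv_pos hV hy]
    abel
  simp only [vectorLaplacian, key, smul_neg, smul_add, smul_smul, Finset.sum_neg_distrib,
    Finset.sum_add_distrib, ← Finset.sum_smul, hn, traceShape, neg_smul]
  abel

/-- The Codazzi equation: `⟨∇_i ∇_j ν, ∂_l x⟩ = ⟨∂_i ∂_l ν, ∂_j x⟩ - ⟨∂_j ν, ∂_i ∂_l x⟩`. -/
lemma codazzi (hV : Module.finrank ℝ V = n + 2) (hy : y ∈ U) (i j l : Fin n) :
    ⟪pderiv i (pderiv j ν) y, pderiv l x y⟫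
        - ∑ k, christoffel (inducedMetric x) k i j y * ⟪pderiv k ν y, pderiv l x y⟫
      = ⟪pderiv i (pderiv l ν) y, pderiv j x y⟫ - ⟪pderiv j ν y, pderiv i (pderiv l x) y⟫ := by
  -- Both sides are `∂_i` of the symmetric expression `⟨∂_j ν, ∂_l x⟩`.
  have h1 : ⟪pderiv i (pderiv j ν) y, pderiv l x y⟫ + ⟪pderiv j ν y, pderiv i (pderiv l x) y⟫
      = ⟪pderiv i (pderiv l ν) y, pderiv j x y⟫ + ⟪pderiv l ν y, pderiv i (pderiv j x) y⟫ := by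
    rw [← pderiv_inner (h.differentiableAt_pderiv_normal hy j) (h.differentiableAt_pderiv_pos hy l),
      ← pderiv_inner (h.differentiableAt_pderiv_normal hy l) (h.differentiableAt_pderiv_pos hy j)]
    refine pderiv_congr ?_ i
    filter_upwards [h.isOpen.mem_nhds hy] with z hz
    exact h.inner_pderiv_normal_pderiv_pos_comm hz j l
  -- Since `∂_l ν` is orthogonal to `ν` and `x`, only the Christoffel part of the Gauss formula
  -- survives.
  have h2 : ⟪pderiv l ν y, pderiv i (pderiv j x) y⟫
      = ∑ k, christoffel (inducedMetric x) k i j y * ⟪pderiv k ν y, pderiv l x y⟫ := by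
    rw [h.pderiv_pderiv_pos hV hy]
    simp only [inner_sub_right, inner_sum, real_inner_smul_right, h.inner_pderiv_normal_normal hy,
      h.inner_pderiv_normal_pos hy, mul_zero, sub_zero]
    exact Finset.sum_congr rfl fun k _ => by rw [h.inner_pderiv_normal_pderiv_pos_comm hy]
  linarith

/-- `⟨Δν, ∂_l x⟩ = -∂_l (n H)`. -/
lemma inner_vectorLaplacian_normal_pderiv_pos (hV : Module.finrank ℝ V = n + 2) (hy : y ∈ U)
    (l : Fin n) :
    ⟪vectorLaplacian (inducedMetric x) ν y, pderiv l x y⟫ = -pderiv l (traceShape x ν) y := by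
  -- In matrix form `traceShape = -tr(P N)`, where `N` is minus the second fundamental form and `∂_l
  -- g = C + Cᵀ`. Differentiating `P` contributes `-2 tr(P C P N)` to `∂_l tr(P N)` and
  -- differentiating `∂_j x` contributes `tr(P C P N)`. The net `-tr(P C P N)` is exactly the
  -- correction term in the contracted Codazzi equation.
  set P := (inducedMetric x y)⁻¹ with hP
  set N : Matrix (Fin n) (Fin n) ℝ := Matrix.of fun i j => ⟪pderiv i ν y, pderiv j x y⟫ with hN
  set C : Matrix (Fin n) (Fin n) ℝ :=
    Matrix.of fun i j => ⟪pderiv l (pderiv i x) y, pderiv j x y⟫ with hC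
  have hPs : P.transpose = P := by
    ext i j
    exact Matrix.gram_inv_comm _ _ _
  have hNs : N.transpose = N := by
    ext i j
    exact h.inner_pderiv_normal_pderiv_pos_comm hy j i
  have hPd := fun i j => differentiableAt_inv_apply (h.differentiableAt_inducedMetric hy)
    (h.isUnit_det_inducedMetric hy) i j
  have hNd := fun i j =>
    (h.differentiableAt_pderiv_normal hy i).inner ℝ (h.differentiableAt_pderiv_pos hy j)
  have hdP : ∀ i j, pderiv l (fun z => (inducedMetric x z)⁻¹ i j) y
      = -(P * (C + C.transpose) * P) i j := by
    intro i j
    rw [pderiv_inv_apply (h.differentiableAt_inducedMetric hy) (h.isUnit_det_inducedMetric hy)]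
    have : Matrix.of (fun a b => pderiv l (fun z => inducedMetric x z a b) y)
        = C + C.transpose := by
      ext a b
      simp only [Matrix.of_apply, h.pderiv_inducedMetric hy, hC, Matrix.add_apply,
        Matrix.transpose_apply, real_inner_comm (pderiv a x y)]
    rw [this]
  -- Expand the tangent vector `∂_j ν` in the frame `∂_k x`.
  have hD : ∀ i j, ⟪pderiv j ν y, pderiv l (pderiv i x) y⟫ = (C * P * N) i j := by
    intro i j
    conv_lhs => rw [h.eq_sum_frame hV hy (pderiv j ν y)]
    rw [h.inner_pderiv_normal_normal hy, h.inner_pderiv_normal_pos hy, zero_smul, zero_smul,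
      add_zero, add_zero, sum_inner, mul_assoc, Matrix.mul_apply]
    refine Finset.sum_congr rfl fun k _ => ?_
    rw [real_inner_smul_left, real_inner_comm, mul_comm, Matrix.mul_apply]
    congr 1
    exact Finset.sum_congr rfl fun m _ => by
      rw [h.inner_pderiv_normal_pderiv_pos_comm hy]; rfl
  have htrace : ∀ A : Matrix (Fin n) (Fin n) ℝ, ∑ i, ∑ j, P i j * A i j = (P * A).trace := by
    intro A
    conv_rhs => rw [Matrix.trace_mul_comm, ← hPs]
    simp only [Matrix.trace, Matrix.diag_apply, Matrix.mul_apply, Matrix.transpose_apply]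
    exact Finset.sum_congr rfl fun i _ => Finset.sum_congr rfl fun j _ => mul_comm _ _
  set Q := P * (C + C.transpose) * P with hQdef
  -- Transposition and cyclicity of the trace identify the `C` and `Cᵀ` contributions, since `P` and
  -- `N` are symmetric.
  have hcyc : (Q * N).trace = 2 * (P * (C * P * N)).trace := by
    have : (P * C.transpose * P * N).trace = (P * C * P * N).trace := by
      rw [← Matrix.trace_transpose]
      simp only [Matrix.transpose_mul, Matrix.transpose_transpose, hPs, hNs]
      rw [Matrix.trace_mul_comm]
      simp only [mul_assoc]
    rw [hQdef, mul_add, add_mul, add_mul, Matrix.trace_add, this, two_mul]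
    simp only [mul_assoc]
  have hderiv : pderiv l (traceShape x ν) y = -∑ i, ∑ j,
      (-Q i j * N i j
        + P i j * (⟪pderiv l (pderiv i ν) y, pderiv j x y⟫
          + ⟪pderiv i ν y, pderiv l (pderiv j x) y⟫)) := by
    unfold traceShape
    rw [pderiv_neg, pderiv_sum
      (f := fun i z => ∑ j, (inducedMetric x z)⁻¹ i j * ⟪pderiv i ν z, pderiv j x z⟫) _
      fun i _ => DifferentiableAt.fun_sum fun j _ => (hPd i j).mul (hNd i j)]
    refine congrArg _ (Finset.sum_congr rfl fun i _ => ?_)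
    rw [pderiv_sum (f := fun j z => (inducedMetric x z)⁻¹ i j * ⟪pderiv i ν z, pderiv j x z⟫) _
      fun j _ => (hPd i j).mul (hNd i j)]
    refine Finset.sum_congr rfl fun j _ => ?_
    rw [pderiv_mul (hPd i j) (hNd i j), hdP, pderiv_inner (h.differentiableAt_pderiv_normal hy i)
      (h.differentiableAt_pderiv_pos hy j)]
    rfl
  have hQ : ∑ i, ∑ j, Q i j * N i j
      = (Q * N).trace := by
    simp only [Matrix.trace, Matrix.diag_apply, Matrix.mul_apply (N := N)]
    exact Finset.sum_congr rfl fun i _ => Finset.sum_congr rfl fun j _ => by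
      conv_rhs => rw [← hNs, Matrix.transpose_apply]
  have hD' : ∀ i j, ⟪pderiv i ν y, pderiv l (pderiv j x) y⟫ = (C * P * N).transpose i j :=
    fun i j => hD j i
  have ht : (P * (C * P * N).transpose).trace = (P * (C * P * N)).trace := by
    rw [← Matrix.trace_transpose, Matrix.transpose_mul, Matrix.transpose_transpose, hPs,
      Matrix.trace_mul_comm]
  have hL : ⟪vectorLaplacian (inducedMetric x) ν y, pderiv l x y⟫
      = ∑ i, ∑ j, P i j * (⟪pderiv l (pderiv i ν) y, pderiv j x y⟫ - (C * P * N) i j) := by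
    rw [inner_vectorLaplacian]
    refine Finset.sum_congr rfl fun i _ => Finset.sum_congr rfl fun j _ => ?_
    rw [h.codazzi hV hy, pderiv_comm (h.contDiffAt_pos y hy) i l,
      pderiv_comm (h.contDiffAt_normal y hy) i l, hD]
  rw [hL, hderiv]
  simp only [hD', mul_sub, mul_add, neg_mul, Finset.sum_sub_distrib, Finset.sum_add_distrib,
    Finset.sum_neg_distrib, htrace, hQ, hcyc, ht]
  ring

end IsSphereHypersurfaceOn

end LocalRiemannian

/-! ### The hypersurface in a chart -/

section Charts

variable {n : ℕ} {M : Type*} [TopologicalSpace M] [ChartedSpace (EuclideanSpace ℝ (Fin n)) M]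
  [IsManifold (𝓡 n) ∞ M]

/-- The coordinate basis of a tangent space. -/
lemma exists_coordinate_basis (p : M) {y : EuclideanSpace ℝ (Fin n)}
    (hy : y ∈ (extChartAt (𝓡 n) p).target) {q : M} (hq : (extChartAt (𝓡 n) p).symm y = q) :
    ∃ b : Module.Basis (Fin n) ℝ (TangentSpace (𝓡 n) q),
      ∀ {F : Type} [NormedAddCommGroup F] [NormedSpace ℝ F] (f : M → F),
        MDifferentiableAt (𝓡 n) 𝓘(ℝ, F) f q →
        ∀ i, LocalRiemannian.pderiv i (f ∘ (extChartAt (𝓡 n) p).symm) y =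
          mfderiv (𝓡 n) 𝓘(ℝ, F) f q (b i) := by
  -- Keeping `q` separate from `symm y` in the statement lets the basis live in the tangent space at
  -- `p` itself when `y` is the image of `p`.
  subst hq
  have : IsManifold (𝓡 n) 1 M := .of_le (n := ∞) (by simp)
  obtain ⟨L, hL⟩ := isInvertible_mfderivWithin_extChartAt_symm (I := 𝓡 n) hy
  have hd := mdifferentiableWithinAt_extChartAt_symm (I := 𝓡 n) hy
  simp only [modelWithCornersSelf_coe, Set.range_id, mdifferentiableWithinAt_univ,
    mfderivWithin_univ] at hd hL
  refine ⟨(EuclideanSpace.basisFun (Fin n) ℝ).toBasis.map L.toLinearEquiv, ?_⟩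
  intro F _ _ f hf i
  rw [LocalRiemannian.pderiv, ← mfderiv_eq_fderiv, mfderiv_comp y hf hd, ← hL]
  have hi : (EuclideanSpace.basisFun (Fin n) ℝ).toBasis i = EuclideanSpace.single i 1 := by simp
  exact congrArg (fun v => mfderiv (𝓡 n) 𝓘(ℝ, F) f _ (L v)) hi.symm

end Charts

namespace SphereHypersurface

open LocalRiemannian

variable {n : ℕ} {M : Type*} [TopologicalSpace M] [ChartedSpace (EuclideanSpace ℝ (Fin n)) M]
  (X : SphereHypersurface n M)

/-- The position vector in the chart around `p`. -/
def posInChart (p : M) : EuclideanSpace ℝ (Fin n) → EuclideanSpace ℝ (Fin (n + 2)) :=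
  X.pos ∘ (extChartAt (𝓡 n) p).symm

/-- The unit normal in the chart around `p`. -/
def normalInChart (p : M) : EuclideanSpace ℝ (Fin n) → EuclideanSpace ℝ (Fin (n + 2)) :=
  X.normal ∘ (extChartAt (𝓡 n) p).symm

lemma mdifferentiableAt_pos (q : M) :
    MDifferentiableAt (𝓡 n) 𝓘(ℝ, EuclideanSpace ℝ (Fin (n + 2))) X.pos q :=
  X.smooth_pos.mdifferentiableAt (by simp)

lemma mdifferentiableAt_normal (q : M) :
    MDifferentiableAt (𝓡 n) 𝓘(ℝ, EuclideanSpace ℝ (Fin (n + 2))) X.normal q :=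
  X.smooth_normal.mdifferentiableAt (by simp)

lemma continuousAt_of_comp_extChartAt_symm {f : M → ℝ} {p : M}
    (hf : ContinuousAt (f ∘ (extChartAt (𝓡 n) p).symm) (extChartAt (𝓡 n) p p)) :
    ContinuousAt f p := by
  refine (hf.comp (continuousAt_extChartAt p)).congr ?_
  filter_upwards [extChartAt_source_mem_nhds (I := 𝓡 n) p] with q hq
  simp only [Function.comp_apply]
  rw [(extChartAt (𝓡 n) p).left_inv hq]

lemma posInChart_self (p : M) : X.posInChart p (extChartAt (𝓡 n) p p) = X.pos p := by
  simp [posInChart]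

lemma normalInChart_self (p : M) : X.normalInChart p (extChartAt (𝓡 n) p p) = X.normal p := by
  simp [normalInChart]

lemma inner_normal_pos (p : M) : ⟪X.normal p, X.pos p⟫ = 0 := by
  rw [real_inner_comm, X.inner_pos_normal]

variable [IsManifold (𝓡 n) ∞ M]

lemma contDiffAt_comp_extChartAt_symm {F : Type*} [NormedAddCommGroup F] [NormedSpace ℝ F]
    {f : M → F} (hf : ContMDiff (𝓡 n) 𝓘(ℝ, F) ∞ f) (p : M) {y : EuclideanSpace ℝ (Fin n)}
    (hy : y ∈ (extChartAt (𝓡 n) p).target) :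
    ContDiffAt ℝ ∞ (f ∘ (extChartAt (𝓡 n) p).symm) y := by
  have := hf.comp_contMDiffOn (contMDiffOn_extChartAt_symm (I := 𝓡 n) (n := ∞) p)
  exact (contMDiffOn_iff_contDiffOn.1 this).contDiffAt ((isOpen_extChartAt_target p).mem_nhds hy)

lemma isSphereHypersurfaceOn (p : M) :
    IsSphereHypersurfaceOn (extChartAt (𝓡 n) p).target (X.posInChart p) (X.normalInChart p) where
  isOpen := isOpen_extChartAt_target p
  contDiffAt_pos _ hy := contDiffAt_comp_extChartAt_symm X.smooth_pos p hy
  contDiffAt_normal _ hy := contDiffAt_comp_extChartAt_symm X.smooth_normal p hy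
  norm_pos _ _ := X.norm_pos _
  norm_normal _ _ := X.norm_normal _
  inner_pos_normal _ _ := X.inner_pos_normal _
  inner_pderiv_pos_normal y hy i := by
    obtain ⟨b, hb⟩ := exists_coordinate_basis p hy rfl
    rw [posInChart, hb _ (X.mdifferentiableAt_pos _)]
    exact X.inner_mfderiv_normal _ _
  linearIndependent y hy := by
    obtain ⟨b, hb⟩ := exists_coordinate_basis p hy rfl
    simp only [posInChart, hb _ (X.mdifferentiableAt_pos _)]
    exact b.linearIndependent.map' (euclideanDifferential n X.pos _)
      (LinearMap.ker_eq_bot.2 (X.immersion _))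

/-- The coordinate basis of the tangent space of the hypersurface. -/
lemma exists_tangent_basis (p : M) {y : EuclideanSpace ℝ (Fin n)}
    (hy : y ∈ (extChartAt (𝓡 n) p).target) {q : M} (hq : (extChartAt (𝓡 n) p).symm y = q) :
    ∃ b : Module.Basis (Fin n) ℝ (X.tangent q),
      (∀ i, (b i : EuclideanSpace ℝ (Fin (n + 2))) = pderiv i (X.posInChart p) y) ∧
      ∀ i, (X.shapeOperator _ (b i) : EuclideanSpace ℝ (Fin (n + 2)))
        = -pderiv i (X.normalInChart p) y := by
  obtain ⟨b, hb⟩ := exists_coordinate_basis p hy hq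
  have hpos : ∀ i, (X.tangentEquiv q (b i) : EuclideanSpace ℝ (Fin (n + 2)))
      = pderiv i (X.posInChart p) y := fun i => by
    rw [posInChart, hb _ (X.mdifferentiableAt_pos _)]
    rfl
  refine ⟨b.map (X.tangentEquiv q), fun i => by rw [Module.Basis.map_apply, hpos], fun i => ?_⟩
  have h := X.isSphereHypersurfaceOn p
  have hN : pderiv i (X.normalInChart p) y = euclideanDifferential n X.normal q (b i) := by
    rw [normalInChart, hb _ (X.mdifferentiableAt_normal _)]
    rfl
  -- `∂_i ν` is orthogonal to `ν` and `x`, hence already tangent; the projection in the shape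
  -- operator leaves it unchanged.
  have hmem : pderiv i (X.normalInChart p) y ∈ X.tangent q := by
    rw [h.eq_sum_frame (by simp) hy (pderiv i (X.normalInChart p) y),
      h.inner_pderiv_normal_normal hy, h.inner_pderiv_normal_pos hy, zero_smul, zero_smul,
      add_zero, add_zero]
    refine Submodule.sum_mem _ fun k _ => Submodule.smul_mem _ _ ?_
    rw [← hpos k]
    exact (X.tangentEquiv q (b k)).2
  have : X.shapeOperator q (b.map (X.tangentEquiv q) i)
      = -(X.tangent q).orthogonalProjectionOnto (pderiv i (X.normalInChart p) y) := by
    rw [hN]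
    simp [shapeOperator]
  rw [this, Submodule.coe_neg, neg_inj]
  exact congrArg Subtype.val
    (Submodule.orthogonalProjectionOnto_mem_subspace_eq_self
      (⟨pderiv i (X.normalInChart p) y, hmem⟩ : X.tangent q))

/-- Stated on the whole chart target, not only at the image of `p`, because `H` has to be
differentiated. -/
lemma trace_shapeOperator (p : M) {y : EuclideanSpace ℝ (Fin n)}
    (hy : y ∈ (extChartAt (𝓡 n) p).target) :
    LinearMap.trace ℝ _ (X.shapeOperator ((extChartAt (𝓡 n) p).symm y))
      = traceShape (X.posInChart p) (X.normalInChart p) y := by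
  obtain ⟨b, hb, hA⟩ := X.exists_tangent_basis p hy rfl
  have hG : Matrix.gram ℝ b = inducedMetric (X.posInChart p) y := by
    ext i j
    simp only [inducedMetric, Matrix.gram_apply, Submodule.coe_inner, hb]
  rw [LinearMap.trace_eq_sum_inv_gram b, hG, traceShape, ← Finset.sum_neg_distrib]
  refine Finset.sum_congr rfl fun i _ => ?_
  rw [← Finset.sum_neg_distrib]
  refine Finset.sum_congr rfl fun j _ => ?_
  rw [Submodule.coe_inner, hA, hb, inner_neg_left, mul_neg]

/-- Writing `S = tr(A* A)` removes the orthonormal basis, and the trace can then be read in the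
coordinate basis. -/
lemma squaredLength_symm (p : M) {y : EuclideanSpace ℝ (Fin n)}
    (hy : y ∈ (extChartAt (𝓡 n) p).target) :
    X.squaredLength ((extChartAt (𝓡 n) p).symm y)
      = sqLength (X.posInChart p) (X.normalInChart p) y := by
  obtain ⟨b, hb, hA⟩ := X.exists_tangent_basis p hy rfl
  have hG : Matrix.gram ℝ b = inducedMetric (X.posInChart p) y := by
    ext i j
    simp only [inducedMetric, Matrix.gram_apply, Submodule.coe_inner, hb]
  set A := X.shapeOperator ((extChartAt (𝓡 n) p).symm y)
  have : X.squaredLength ((extChartAt (𝓡 n) p).symm y)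
      = LinearMap.trace ℝ _ (LinearMap.adjoint A ∘ₗ A) := by
    rw [LinearMap.trace_eq_sum_inner _ (stdOrthonormalBasis ℝ _), squaredLength]
    refine Finset.sum_congr rfl fun i _ => ?_
    rw [LinearMap.comp_apply, LinearMap.adjoint_inner_right, real_inner_self_eq_norm_sq]
  rw [this, LinearMap.trace_eq_sum_inv_gram b, hG, sqLength]
  refine Finset.sum_congr rfl fun i _ => Finset.sum_congr rfl fun j _ => ?_
  rw [LinearMap.comp_apply, LinearMap.adjoint_inner_left, Submodule.coe_inner, hA, hA, inner_neg_neg]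

lemma traceShape_extChartAt_self (p : M) (hn : 1 ≤ n) :
    traceShape (X.posInChart p) (X.normalInChart p) (extChartAt (𝓡 n) p p)
      = n * X.meanCurvature p := by
  have hn' : (n : ℝ) ≠ 0 := by positivity
  have := X.trace_shapeOperator p (mem_extChartAt_target p)
  rw [← this, extChartAt_to_inv, meanCurvature, mul_div_cancel₀ _ hn']

lemma sqLength_extChartAt_self (p : M) :
    sqLength (X.posInChart p) (X.normalInChart p) (extChartAt (𝓡 n) p p) = X.squaredLength p := by
  rw [← X.squaredLength_symm p (mem_extChartAt_target p), extChartAt_to_inv]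

lemma meanCurvature_comp_symm (p : M) {y : EuclideanSpace ℝ (Fin n)}
    (hy : y ∈ (extChartAt (𝓡 n) p).target) :
    X.meanCurvature ∘ (extChartAt (𝓡 n) p).symm =ᶠ[nhds y]
      fun z => (n : ℝ)⁻¹ • traceShape (X.posInChart p) (X.normalInChart p) z := by
  filter_upwards [(isOpen_extChartAt_target p).mem_nhds hy] with z hz
  rw [← X.trace_shapeOperator p hz, Function.comp_apply, meanCurvature, smul_eq_mul]
  ring

lemma differentiableAt_meanCurvature_comp_symm (p : M) {y : EuclideanSpace ℝ (Fin n)}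
    (hy : y ∈ (extChartAt (𝓡 n) p).target) :
    DifferentiableAt ℝ (X.meanCurvature ∘ (extChartAt (𝓡 n) p).symm) y :=
  (((X.isSphereHypersurfaceOn p).differentiableAt_traceShape hy).const_smul
    (n : ℝ)⁻¹).congr_of_eventuallyEq (X.meanCurvature_comp_symm p hy)

lemma continuous_squaredLength : Continuous X.squaredLength := by
  refine continuous_iff_continuousAt.2 fun p => continuousAt_of_comp_extChartAt_symm (n := n) ?_
  have hy := mem_extChartAt_target (I := 𝓡 n) p
  refine ((X.isSphereHypersurfaceOn p).differentiableAt_sqLength hy).continuousAt.congr ?_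
  filter_upwards [(isOpen_extChartAt_target p).mem_nhds hy] with z hz
  exact (X.squaredLength_symm p hz).symm

lemma mdifferentiableAt_meanCurvature (p : M) :
    MDifferentiableAt (𝓡 n) 𝓘(ℝ, ℝ) X.meanCurvature p := by
  have hd := X.differentiableAt_meanCurvature_comp_symm p (mem_extChartAt_target p)
  rw [mdifferentiableAt_iff]
  refine ⟨continuousAt_of_comp_extChartAt_symm hd.continuousAt, ?_⟩
  rw [ModelWithCorners.range_eq_univ]
  exact hd.differentiableWithinAt

/-! ### The Laplacians of the height functions -/

lemma laplacian_eq_inner_vectorLaplacian {f : M → EuclideanSpace ℝ (Fin (n + 2))}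
    (hf : ContMDiff (𝓡 n) 𝓘(ℝ, EuclideanSpace ℝ (Fin (n + 2))) ∞ f)
    (a : EuclideanSpace ℝ (Fin (n + 2))) (p : M) :
    X.laplacian (fun q => ⟪f q, a⟫) p =
      ⟪vectorLaplacian (inducedMetric (X.posInChart p)) (f ∘ (extChartAt (𝓡 n) p).symm)
        (extChartAt (𝓡 n) p p), a⟫ := by
  refine laplacian_inner_const _ ?_ a
  filter_upwards [(isOpen_extChartAt_target p).mem_nhds (mem_extChartAt_target p)] with z hz
  exact contDiffAt_comp_extChartAt_symm hf p hz

/-- `Δ φ_a = -n φ_a + n H ψ_a`. -/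
lemma laplacian_phi (hn : 1 ≤ n) (a : EuclideanSpace ℝ (Fin (n + 2))) (p : M) :
    X.laplacian (X.phi a) p = -n * X.phi a p + n * X.meanCurvature p * X.psi a p := by
  refine (X.laplacian_eq_inner_vectorLaplacian X.smooth_pos a p).trans ?_
  have := (X.isSphereHypersurfaceOn p).vectorLaplacian_pos (by simp) (mem_extChartAt_target p)
  rw [← posInChart, this, X.traceShape_extChartAt_self p hn, posInChart_self, normalInChart_self,
    inner_sub_left, real_inner_smul_left, real_inner_smul_left, phi, psi]
  ring

/-- The tangential vector `Δν + S ν - n H x`, which equals `-n` times the gradient of `H`. -/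
def tangentialLaplacianNormal (p : M) : EuclideanSpace ℝ (Fin (n + 2)) :=
  vectorLaplacian (inducedMetric (X.posInChart p)) (X.normalInChart p) (extChartAt (𝓡 n) p p)
    + X.squaredLength p • X.normal p - (n * X.meanCurvature p) • X.pos p

/-- `Δ ψ_a = -S ψ_a + n H φ_a - n ⟨∇H, a⟩`. -/
lemma laplacian_psi (a : EuclideanSpace ℝ (Fin (n + 2))) (p : M) :
    X.laplacian (X.psi a) p = -X.squaredLength p * X.psi a p + n * X.meanCurvature p * X.phi a p
      + ⟪X.tangentialLaplacianNormal p, a⟫ := by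
  refine (X.laplacian_eq_inner_vectorLaplacian X.smooth_normal a p).trans ?_
  rw [tangentialLaplacianNormal, inner_sub_left, inner_add_left, real_inner_smul_left,
    real_inner_smul_left, phi, psi, normalInChart]
  ring

lemma inner_tangentialLaplacianNormal_pos (hn : 1 ≤ n) (p : M) :
    ⟪X.tangentialLaplacianNormal p, X.pos p⟫ = 0 := by
  have h := (X.isSphereHypersurfaceOn p).inner_vectorLaplacian_normal_pos (mem_extChartAt_target p)
  rw [posInChart_self, X.traceShape_extChartAt_self p hn] at h
  rw [tangentialLaplacianNormal, inner_sub_left, inner_add_left, real_inner_smul_left,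
    real_inner_smul_left, h, X.inner_normal_pos, real_inner_self_eq_norm_sq, X.norm_pos]
  ring

lemma inner_tangentialLaplacianNormal_normal (p : M) :
    ⟪X.tangentialLaplacianNormal p, X.normal p⟫ = 0 := by
  have h := (X.isSphereHypersurfaceOn p).inner_vectorLaplacian_normal_normal
    (mem_extChartAt_target p)
  rw [normalInChart_self, X.sqLength_extChartAt_self p] at h
  rw [tangentialLaplacianNormal, inner_sub_left, inner_add_left, real_inner_smul_left,
    real_inner_smul_left, h, X.inner_pos_normal, real_inner_self_eq_norm_sq, X.norm_normal]
  ring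

lemma inner_tangentialLaplacianNormal_pderiv (p : M) (l : Fin n) :
    ⟪X.tangentialLaplacianNormal p, pderiv l (X.posInChart p) (extChartAt (𝓡 n) p p)⟫ =
      -pderiv l (traceShape (X.posInChart p) (X.normalInChart p)) (extChartAt (𝓡 n) p p) := by
  have hS := X.isSphereHypersurfaceOn p
  have hy := mem_extChartAt_target (I := 𝓡 n) p
  have h1 := hS.inner_pderiv_pos_normal _ hy l
  have h2 := hS.inner_pderiv_pos_pos hy l
  rw [normalInChart_self, real_inner_comm] at h1
  rw [posInChart_self, real_inner_comm] at h2
  rw [tangentialLaplacianNormal, inner_sub_left, inner_add_left, real_inner_smul_left,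
    real_inner_smul_left, h1, h2, hS.inner_vectorLaplacian_normal_pderiv_pos (by simp) hy]
  ring

/-- Its components along `x` and `ν` always vanish, and those along `∂_l x` are the derivatives
`-∂_l (n H)`. -/
lemma tangentialLaplacianNormal_eq_zero (hn : 1 ≤ n) {c : ℝ} (hc : ∀ p, X.meanCurvature p = c)
    (p : M) : X.tangentialLaplacianNormal p = 0 := by
  have hS := X.isSphereHypersurfaceOn p
  have hy := mem_extChartAt_target (I := 𝓡 n) p
  have hn' : (n : ℝ) ≠ 0 := by positivity
  refine eq_zero_of_inner_frame (n := n) (by simp) (hS.linearIndependent _ hy) (hS.norm_pos _ hy)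
    (hS.norm_normal _ hy) (hS.inner_pos_normal _ hy) (hS.inner_pderiv_pos_pos hy)
    (hS.inner_pderiv_pos_normal _ hy) (fun l => ?_) ?_ ?_
  · rw [inner_tangentialLaplacianNormal_pderiv, neg_eq_zero]
    refine pderiv_eventually_const (c := n * c) ?_ l
    filter_upwards [(isOpen_extChartAt_target p).mem_nhds hy] with z hz
    rw [← X.trace_shapeOperator p hz, ← hc ((extChartAt (𝓡 n) p).symm z), meanCurvature,
      mul_div_cancel₀ _ hn']
  · rw [posInChart_self, X.inner_tangentialLaplacianNormal_pos hn]
  · rw [normalInChart_self, X.inner_tangentialLaplacianNormal_normal]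

/-- A function with vanishing differential on a connected manifold is constant. -/
lemma exists_eq_const_of_mfderiv_eq_zero [ConnectedSpace M] {f : M → ℝ}
    (hf : ∀ p, MDifferentiableAt (𝓡 n) 𝓘(ℝ, ℝ) f p) (hf' : ∀ p, mfderiv (𝓡 n) 𝓘(ℝ, ℝ) f p = 0) :
    ∃ c, ∀ p, f p = c := by
  have hloc : IsLocallyConstant f := by
    refine (IsLocallyConstant.iff_eventually_eq f).2 fun p => ?_
    have hopen := isOpen_extChartAt_target (I := 𝓡 n) p
    obtain ⟨ε, hε, hball⟩ := Metric.isOpen_iff.1 hopen _ (mem_extChartAt_target p)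
    set y := extChartAt (𝓡 n) p p
    have hpd : ∀ z ∈ (extChartAt (𝓡 n) p).target, ∀ i,
        pderiv i (f ∘ (extChartAt (𝓡 n) p).symm) z = 0 := by
      intro z hz i
      obtain ⟨b, hb⟩ := exists_coordinate_basis p hz rfl
      rw [hb f (hf _), hf']
      rfl
    have hdiff : DifferentiableOn ℝ (f ∘ (extChartAt (𝓡 n) p).symm) (Metric.ball y ε) := by
      have : IsManifold (𝓡 n) 1 M := .of_le (n := ∞) (by simp)
      intro z hz
      have hd := mdifferentiableWithinAt_extChartAt_symm (I := 𝓡 n) (hball hz)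
      simp only [modelWithCornersSelf_coe, Set.range_id, mdifferentiableWithinAt_univ] at hd
      exact ((hf _).comp z hd).differentiableAt.differentiableWithinAt
    -- A ball is convex, hence preconnected, so a vanishing derivative forces constancy on it.
    have hconst : ∀ z ∈ Metric.ball y ε, f ((extChartAt (𝓡 n) p).symm z) = f p := by
      intro z hz
      have := Metric.isOpen_ball.is_const_of_fderiv_eq_zero
        (convex_ball y ε).isPreconnected hdiff
        (fun w hw => fderiv_eq_zero_of_pderiv_eq_zero (hpd w (hball hw))) hz
        (Metric.mem_ball_self hε)
      simpa [y] using this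
    filter_upwards [extChartAt_source_mem_nhds (I := 𝓡 n) p,
      (continuousAt_extChartAt (I := 𝓡 n) p).preimage_mem_nhds (Metric.ball_mem_nhds y hε)]
      with q hq hqy
    rw [← hconst _ hqy, (extChartAt (𝓡 n) p).left_inv hq]
  exact hloc.exists_eq_const.imp fun c hc p => congrFun hc p

/-- The tangential components are `-∂_l (n H)`, so their vanishing at every point gives `dH = 0`;
connectedness does the rest. -/
lemma exists_meanCurvature_eq_const [ConnectedSpace M]
    (h : ∀ p, X.tangentialLaplacianNormal p = 0) : ∃ c, ∀ p, X.meanCurvature p = c := by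
  refine exists_eq_const_of_mfderiv_eq_zero X.mdifferentiableAt_meanCurvature fun p => ?_
  have hy := mem_extChartAt_target (I := 𝓡 n) p
  have h0 : ∀ l, pderiv l (X.meanCurvature ∘ (extChartAt (𝓡 n) p).symm)
      (extChartAt (𝓡 n) p p) = 0 := by
    intro l
    have hd := (X.isSphereHypersurfaceOn p).differentiableAt_traceShape hy
    have := X.inner_tangentialLaplacianNormal_pderiv p l
    rw [h p, inner_zero_left, eq_comm, neg_eq_zero] at this
    rw [pderiv_congr (X.meanCurvature_comp_symm p hy), pderiv, fderiv_fun_const_smul hd]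
    rw [smul_apply, ← pderiv, this, smul_zero]
  obtain ⟨b, hb⟩ := exists_coordinate_basis p hy (extChartAt_to_inv (I := 𝓡 n) p)
  have : (mfderiv (𝓡 n) 𝓘(ℝ, ℝ) X.meanCurvature p).toLinearMap = 0 :=
    b.ext fun i => (hb X.meanCurvature (X.mdifferentiableAt_meanCurvature p) i).symm.trans (h0 i)
  exact ContinuousLinearMap.coe_injective this

/-! ### Comparison of coefficients -/

lemma eq_zero_of_inner_unit {V : Type*} [NormedAddCommGroup V] [InnerProductSpace ℝ V] {u : V}
    (h : ∀ a : V, ‖a‖ = 1 → ⟪u, a⟫ = 0) : u = 0 := by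
  by_contra hu
  have := h (‖u‖⁻¹ • u) (by simp [norm_smul, hu])
  rw [real_inner_smul_right, real_inner_self_eq_norm_sq] at this
  simp [hu] at this

/-- The unit vectors `x(p)` and `ν(p)` are orthogonal: `a = x(p)` yields `lam`, and `a = ν(p)`
yields `mu`. -/
lemma coefficients_phi (hn : 1 ≤ n) {lam mu : ℝ} {p : M}
    (h : ∀ a : EuclideanSpace ℝ (Fin (n + 2)), ‖a‖ = 1 →
      X.laplacian (X.phi a) p = -lam * X.phi a p + n * mu * X.psi a p) :
    lam = n ∧ mu = X.meanCurvature p := by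
  have hn' : (n : ℝ) ≠ 0 := by positivity
  have h1 := h _ (X.norm_pos p)
  have h2 := h _ (X.norm_normal p)
  simp only [X.laplacian_phi hn, phi, psi, X.inner_pos_normal, X.inner_normal_pos,
    real_inner_self_eq_norm_sq, X.norm_pos, X.norm_normal] at h1 h2
  exact ⟨by linarith, (mul_left_cancel₀ hn' (by linarith))⟩

/-- The residual vector is orthogonal to `x(p)` and `ν(p)`, so these two tests fix `lam` and `mu`;
the remaining `a` then force the residual to vanish. -/
lemma coefficients_psi (hn : 1 ≤ n) {lam mu : ℝ} {p : M}
    (h : ∀ a : EuclideanSpace ℝ (Fin (n + 2)), ‖a‖ = 1 →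
      X.laplacian (X.psi a) p = -lam * X.psi a p + n * mu * X.phi a p) :
    lam = X.squaredLength p ∧ mu = X.meanCurvature p ∧ X.tangentialLaplacianNormal p = 0 := by
  have hn' : (n : ℝ) ≠ 0 := by positivity
  have h1 := h _ (X.norm_pos p)
  have h2 := h _ (X.norm_normal p)
  simp only [X.laplacian_psi, phi, psi, X.inner_pos_normal, X.inner_normal_pos,
    real_inner_self_eq_norm_sq, X.norm_pos, X.norm_normal,
    X.inner_tangentialLaplacianNormal_pos hn, X.inner_tangentialLaplacianNormal_normal] at h1 h2
  have hlam : lam = X.squaredLength p := by linarith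
  have hmu : mu = X.meanCurvature p := mul_left_cancel₀ hn' (by linarith)
  refine ⟨hlam, hmu, eq_zero_of_inner_unit fun a ha => ?_⟩
  have := h a ha
  rw [X.laplacian_psi, hlam, hmu] at this
  linarith

lemma laplacian_psi_of_const (hn : 1 ≤ n) {c : ℝ} (hc : ∀ p, X.meanCurvature p = c)
    (a : EuclideanSpace ℝ (Fin (n + 2))) (p : M) :
    X.laplacian (X.psi a) p = -X.squaredLength p * X.psi a p + n * c * X.phi a p := by
  rw [X.laplacian_psi, X.tangentialLaplacianNormal_eq_zero hn hc, hc, inner_zero_left, add_zero]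

end SphereHypersurface

end

/-! ### The characterizations -/

theorem theorem2p1 {n : ℕ} (hn : 1 ≤ n) {M : Type*} [TopologicalSpace M]
    [ChartedSpace (EuclideanSpace ℝ (Fin n)) M] [IsManifold (𝓡 n) ∞ M] [ConnectedSpace M]
    (X : SphereHypersurface n M) :
    -- (i)
    (((∃ c : ℝ, ∀ p, X.meanCurvature p = c) ↔
        ∃ (lam : M → ℝ) (mu : ℝ), Continuous lam ∧
          ∀ a : EuclideanSpace ℝ (Fin (n + 2)), ‖a‖ = 1 → ∀ p,
            X.laplacian (X.phi a) p = -lam p * X.phi a p + n * mu * X.psi a p) ∧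
      (∀ (lam : M → ℝ) (mu : ℝ), Continuous lam →
          (∀ a : EuclideanSpace ℝ (Fin (n + 2)), ‖a‖ = 1 → ∀ p,
            X.laplacian (X.phi a) p = -lam p * X.phi a p + n * mu * X.psi a p) →
          (∀ p, lam p = n) ∧ (∀ p, mu = X.meanCurvature p)) ∧
      ((∀ p, X.meanCurvature p = 0) ↔
        ∃ lam : M → ℝ, Continuous lam ∧
          ∀ a : EuclideanSpace ℝ (Fin (n + 2)), ‖a‖ = 1 → ∀ p,
            X.laplacian (X.phi a) p = -lam p * X.phi a p)) ∧
    -- (ii)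
    (((∃ c : ℝ, ∀ p, X.meanCurvature p = c) ↔
        ∃ lam mu : M → ℝ, Continuous lam ∧ Continuous mu ∧
          ∀ a : EuclideanSpace ℝ (Fin (n + 2)), ‖a‖ = 1 → ∀ p,
            X.laplacian (X.psi a) p = -lam p * X.psi a p + n * mu p * X.phi a p) ∧
      (∀ lam mu : M → ℝ, Continuous lam → Continuous mu →
          (∀ a : EuclideanSpace ℝ (Fin (n + 2)), ‖a‖ = 1 → ∀ p,
            X.laplacian (X.psi a) p = -lam p * X.psi a p + n * mu p * X.phi a p) →
          (∀ p, lam p = X.squaredLength p) ∧ (∀ p, mu p = X.meanCurvature p) ∧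
            ∃ c : ℝ, ∀ p, mu p = c) ∧
      ((∀ p, X.meanCurvature p = 0) ↔
        ∃ lam : M → ℝ, Continuous lam ∧
          ∀ a : EuclideanSpace ℝ (Fin (n + 2)), ‖a‖ = 1 → ∀ p,
            X.laplacian (X.psi a) p = -lam p * X.psi a p)) ∧
    -- (iii)
    ((((∃ c : ℝ, ∀ p, X.meanCurvature p = c) ∧ (∃ c : ℝ, ∀ p, X.squaredLength p = c)) ↔
        ∃ (lam : ℝ) (mu : M → ℝ), Continuous mu ∧
          ∀ a : EuclideanSpace ℝ (Fin (n + 2)), ‖a‖ = 1 → ∀ p,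
            X.laplacian (X.psi a) p = -lam * X.psi a p + n * mu p * X.phi a p) ∧
      (∀ (lam : ℝ) (mu : M → ℝ), Continuous mu →
          (∀ a : EuclideanSpace ℝ (Fin (n + 2)), ‖a‖ = 1 → ∀ p,
            X.laplacian (X.psi a) p = -lam * X.psi a p + n * mu p * X.phi a p) →
          (∀ p, lam = X.squaredLength p) ∧ (∀ p, mu p = X.meanCurvature p) ∧
            ∃ c : ℝ, ∀ p, mu p = c) ∧
      (((∀ p, X.meanCurvature p = 0) ∧ (∃ c : ℝ, ∀ p, X.squaredLength p = c)) ↔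
        ∃ lam : ℝ, ∀ a : EuclideanSpace ℝ (Fin (n + 2)), ‖a‖ = 1 → ∀ p,
          X.laplacian (X.psi a) p = -lam * X.psi a p)) := by
  refine ⟨⟨⟨?_, ?_⟩, ?_, ⟨?_, ?_⟩⟩, ⟨⟨?_, ?_⟩, ?_, ⟨?_, ?_⟩⟩, ⟨⟨?_, ?_⟩, ?_, ⟨?_, ?_⟩⟩⟩
  · rintro ⟨c, hc⟩
    refine ⟨fun _ => n, c, continuous_const, fun a _ p => ?_⟩
    rw [X.laplacian_phi hn, hc]
  · rintro ⟨lam, mu, _, h⟩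
    exact ⟨mu, fun p => (X.coefficients_phi hn fun a ha => h a ha p).2.symm⟩
  · intro lam mu _ h
    exact ⟨fun p => (X.coefficients_phi hn fun a ha => h a ha p).1,
      fun p => (X.coefficients_phi hn fun a ha => h a ha p).2⟩
  · intro hH
    refine ⟨fun _ => n, continuous_const, fun a _ p => ?_⟩
    rw [X.laplacian_phi hn, hH, mul_zero, zero_mul, add_zero]
  · rintro ⟨lam, _, h⟩ p
    -- The minimal case is the general equation with `mu = 0`, and uniqueness of `mu` gives `H = 0`.
    refine (X.coefficients_phi hn (lam := lam p) (mu := 0) (p := p) fun a ha => ?_).2.symm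
    rw [h a ha, mul_zero, zero_mul, add_zero]
  · rintro ⟨c, hc⟩
    exact ⟨X.squaredLength, fun _ => c, X.continuous_squaredLength, continuous_const,
      fun a _ p => X.laplacian_psi_of_const hn hc a p⟩
  · rintro ⟨lam, mu, _, _, h⟩
    -- Here `mu` is only a function; constancy of `H` comes from the vanishing residual.
    exact X.exists_meanCurvature_eq_const fun p =>
      (X.coefficients_psi hn fun a ha => h a ha p).2.2
  · intro lam mu _ _ h
    have hp := fun p => X.coefficients_psi hn fun a ha => h a ha p
    refine ⟨fun p => (hp p).1, fun p => (hp p).2.1, ?_⟩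
    obtain ⟨c, hc⟩ := X.exists_meanCurvature_eq_const fun p => (hp p).2.2
    exact ⟨c, fun p => (hp p).2.1.trans (hc p)⟩
  · intro hH
    refine ⟨X.squaredLength, X.continuous_squaredLength, fun a _ p => ?_⟩
    rw [X.laplacian_psi_of_const hn hH, mul_zero, zero_mul, add_zero]
  · rintro ⟨lam, _, h⟩ p
    refine (X.coefficients_psi hn (lam := lam p) (mu := 0) (p := p) fun a ha => ?_).2.1.symm
    rw [h a ha, mul_zero, zero_mul, add_zero]
  · rintro ⟨⟨c, hc⟩, ⟨s, hs⟩⟩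
    refine ⟨s, fun _ => c, continuous_const, fun a _ p => ?_⟩
    rw [X.laplacian_psi_of_const hn hc, hs]
  · rintro ⟨lam, mu, _, h⟩
    have hp := fun p => X.coefficients_psi hn fun a ha => h a ha p
    exact ⟨X.exists_meanCurvature_eq_const fun p => (hp p).2.2, lam, fun p => (hp p).1.symm⟩
  · intro lam mu _ h
    have hp := fun p => X.coefficients_psi hn fun a ha => h a ha p
    refine ⟨fun p => (hp p).1, fun p => (hp p).2.1, ?_⟩
    obtain ⟨c, hc⟩ := X.exists_meanCurvature_eq_const fun p => (hp p).2.2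
    exact ⟨c, fun p => (hp p).2.1.trans (hc p)⟩
  · rintro ⟨hH, ⟨s, hs⟩⟩
    refine ⟨s, fun a _ p => ?_⟩
    rw [X.laplacian_psi_of_const hn hH, hs, mul_zero, zero_mul, add_zero]
  · rintro ⟨lam, h⟩
    have hp := fun p => X.coefficients_psi hn (lam := lam) (mu := 0) (p := p) fun a ha => by
      rw [h a ha, mul_zero, zero_mul, add_zero]
    exact ⟨fun p => (hp p).2.1.symm, lam, fun p => (hp p).1.symm⟩
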